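/- Let $F$ be a (formally) real field, i.e. $-1$ is not a sum of squares in $F$. Let $X_F$ be its space of orderings with the Harrison topology, which has the sets $\{P\in X_F : a>_P 0\}$, $a\in F^*$, as a subbasis. Suppose that $F$ has the strong approximation property (SAP): for any two disjoint closed subsets $A,B\subseteq X_F$ there is $a\in F^*$ with $a>_P0$ for all $P\in A$ and $a<_P0$ for all $P\in B$. Let $u(F)\in\mathbb N_0\cup\{\infty\}$ be the supremum of the dimensions of the anisotropic torsion quadratic forms over $F$, where a form $q$ is torsion if the orthogonal sum $m\times q$ is hyperbolic for some integer $m\ge 1$. Let $\tilde u(F)\in\mathbb N_0\cup\{\infty\}$ be the Hasse number of $F$: the supremum of the dimensions of the anisotropic totally indefinite quadratic forms over $F$, i.e. those which take both positive and negative values with respect to every ordering of $F$ (the supremum is $0$ if there are no such forms). All forms are finite-dimensional and nondegenerate. If $u(F)\le 2$, then $u(F)=\tilde u(F)$. -/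

import Mathlib

/-- The space of orderings `X_F` of a field `F` (an ordering is given by its cone of nonnegative
elements). -/
def OrderingSpace (F : Type*) [Field F] : Type _ :=
  {P : RingPreordering F // P.IsOrdering}

/-- `a` is strictly positive with respect to the ordering `P`. -/
def OrderingSpace.IsPos {F : Type*} [Field F] (P : OrderingSpace F) (a : F) : Prop :=
  a ∈ P.1 ∧ a ≠ 0

/-- The Harrison set `H(a)` of all orderings at which `a` is positive. -/
def harrisonSet {F : Type*} [Field F] (a : F) : Set (OrderingSpace F) :=
  {P | P.IsPos a}

/-- The Harrison topology: the sets `H(a)`, for `a ≠ 0`, form a subbasis of open sets. -/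
instance OrderingSpace.instTopologicalSpace (F : Type*) [Field F] :
    TopologicalSpace (OrderingSpace F) :=
  TopologicalSpace.generateFrom {U | ∃ a : F, a ≠ 0 ∧ U = harrisonSet a}

/-- The strong approximation property: for any two disjoint closed sets of orderings there is a
nonzero `a` in `F` that is positive on the first set and negative on the second. -/
def IsSAP (F : Type*) [Field F] : Prop :=
  ∀ A B : Set (OrderingSpace F), IsClosed A → IsClosed B → Disjoint A B →
    ∃ a : F, a ≠ 0 ∧ (∀ P ∈ A, P.IsPos a) ∧ (∀ P ∈ B, P.IsPos (-a))

/-- The orthogonal sum `m × q = q ⊥ ⋯ ⊥ q` of `m` copies of `q`. -/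
noncomputable def orthMultiple {F V : Type*} [Field F] [AddCommGroup V] [Module F V]
    (m : ℕ) (q : QuadraticForm F V) : QuadraticForm F (Fin m → V) :=
  QuadraticMap.pi fun _ : Fin m => q

/-- The form `q` is hyperbolic: it is isometric to the orthogonal sum of `k` hyperbolic planes,
`(f, x) ↦ f x` on `(F ^ k)* ⊕ F ^ k`, for some `k ≥ 0`. -/
def IsHyperbolicForm {F V : Type*} [Field F] [AddCommGroup V] [Module F V]
    (q : QuadraticForm F V) : Prop :=
  ∃ k : ℕ, QuadraticMap.Equivalent q (QuadraticForm.dualProd F (Fin k → F))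

/-- The form `q` is torsion, i.e. its class in the Witt ring has finite order: `m × q` is
hyperbolic for some `m ≥ 1`. -/
def IsTorsionForm {F V : Type*} [Field F] [AddCommGroup V] [Module F V]
    (q : QuadraticForm F V) : Prop :=
  ∃ m : ℕ, 1 ≤ m ∧ IsHyperbolicForm (orthMultiple m q)

/-- The form `q` is indefinite at the ordering `P`: it takes both positive and negative values. -/
def IsIndefiniteAt {F V : Type*} [Field F] [AddCommGroup V] [Module F V]
    (q : QuadraticForm F V) (P : OrderingSpace F) : Prop :=
  (∃ x, P.IsPos (q x)) ∧ (∃ x, P.IsPos (-q x))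

/-- The form `q` is totally indefinite: indefinite at every ordering of `F`. -/
def IsTotallyIndefinite {F V : Type*} [Field F] [AddCommGroup V] [Module F V]
    (q : QuadraticForm F V) : Prop :=
  ∀ P : OrderingSpace F, IsIndefiniteAt q P

/-- The `u`-invariant (for fields of characteristic not `2`): the supremum in `ℕ ∪ {∞}` of the
dimensions of anisotropic torsion forms. An `n`-dimensional form is, up to isometry, a form on
`F ^ n`; anisotropic forms are nondegenerate. -/
noncomputable def uInvariant (F : Type*) [Field F] : ℕ∞ :=
  sSup {d : ℕ∞ | ∃ (n : ℕ) (q : QuadraticForm F (Fin n → F)),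
    q.Anisotropic ∧ IsTorsionForm q ∧ d = n}

/-- The Hasse number (for fields of characteristic not `2`): the supremum in `ℕ ∪ {∞}` of the
dimensions of anisotropic totally indefinite forms (`0` if there are none). -/
noncomputable def hasseNumber (F : Type*) [Field F] : ℕ∞ :=
  sSup {d : ℕ∞ | ∃ (n : ℕ) (q : QuadraticForm F (Fin n → F)),
    q.Anisotropic ∧ IsTotallyIndefinite q ∧ d = n}

/-! ### Orderings and preorderings. -/

section Orderings

variable {F : Type*} [Field F]

/-! A nonzero anisotropic torsion form is totally indefinite, as a hyperbolic multiple of it gives a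
nontrivial vanishing sum of its values; so `u ≤ ũ`. Conversely let `u ≤ 2`. A totally indefinite
`⟨a, b, c⟩` is similar to a subform of the Pfister form `⟨1, ab, ac, bc⟩`, which is torsion by a
local-global principle, hence isotropic, and roundness turns this into a zero of `⟨a, b, c⟩`. For
`⟨a, b⟩ ⊥ r` of higher dimension, SAP supplies a `d` making `⟨a, b, -d⟩` and `⟨d⟩ ⊥ r` both totally
indefinite; the first shows that `⟨a, b⟩` is isotropic or represents `d`, the second is isotropic by
induction. Thus only dimensions at most 2 remain; 1 is excluded because orderings exist, and `⟨a,
b⟩` is matched by the torsion form `⟨1, ab⟩`. -/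

/-- Every preordering of a field is contained in an ordering. -/
theorem RingPreordering.exists_le_isOrdering (T : RingPreordering F) :
    ∃ P : RingPreordering F, T ≤ P ∧ P.IsOrdering := by
  obtain ⟨P, hTP, hP⟩ := zorn_le_nonempty₀ (Set.univ : Set (RingPreordering F))
    (fun c _ hc Q hQ => by
      refine ⟨RingPreordering.mk' (⋃ P ∈ c, (P : Set F)) ?_ ?_ ?_ ?_, trivial, ?_⟩
      · intro x y hx hy
        simp only [Set.mem_iUnion, SetLike.mem_coe, exists_prop] at hx hy ⊢
        obtain ⟨A, hA, hxA⟩ := hx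
        obtain ⟨B, hB, hyB⟩ := hy
        rcases hc.total hA hB with h | h
        · exact ⟨B, hB, add_mem (h hxA) hyB⟩
        · exact ⟨A, hA, add_mem hxA (h hyB)⟩
      · intro x y hx hy
        simp only [Set.mem_iUnion, SetLike.mem_coe, exists_prop] at hx hy ⊢
        obtain ⟨A, hA, hxA⟩ := hx
        obtain ⟨B, hB, hyB⟩ := hy
        rcases hc.total hA hB with h | h
        · exact ⟨B, hB, mul_mem (h hxA) hyB⟩
        · exact ⟨A, hA, mul_mem hxA (h hyB)⟩
      · intro x
        simp only [Set.mem_iUnion, SetLike.mem_coe, exists_prop]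
        exact ⟨Q, hQ, Q.mul_self_mem x⟩
      · simp only [Set.mem_iUnion, SetLike.mem_coe, exists_prop, not_exists, not_and]
        exact fun A _ => A.neg_one_notMem
      · intro A hA x hx
        simp only [RingPreordering.mem_mk', Set.mem_iUnion, SetLike.mem_coe, exists_prop]
        exact ⟨A, hA, hx⟩) T trivial
  have key : ∀ a : F, a ∈ P ∨ -a ∈ P := by
    intro a
    by_contra! h
    obtain ⟨ha, hna⟩ := h
    -- If `a` and `-a` both lie outside the maximal `P`, then `P - aP` is a strictly larger
    -- preordering: `-1 = x - ay` would put `a = (1 + x)/y` in `P`.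
    let Q : RingPreordering F := RingPreordering.mk' {z | ∃ x ∈ P, ∃ y ∈ P, z = x - a * y}
      (by
        rintro _ _ ⟨x, hx, y, hy, rfl⟩ ⟨x', hx', y', hy', rfl⟩
        exact ⟨x + x', add_mem hx hx', y + y', add_mem hy hy', by ring⟩)
      (by
        rintro _ _ ⟨x, hx, y, hy, rfl⟩ ⟨x', hx', y', hy', rfl⟩
        exact ⟨x * x' + a * a * (y * y'),
          add_mem (mul_mem hx hx') (mul_mem (P.mul_self_mem a) (mul_mem hy hy')),
          x * y' + y * x', add_mem (mul_mem hx hy') (mul_mem hy hx'), by ring⟩)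
      (fun x => ⟨x * x, P.mul_self_mem x, 0, zero_mem P, by ring⟩)
      (by
        rintro ⟨x, hx, y, hy, h⟩
        have hy0 : y ≠ 0 := by
          rintro rfl
          exact P.neg_one_notMem (by rw [h]; simpa using hx)
        have : a = (1 + x) * y⁻¹ := by
          field_simp
          linear_combination h
        exact ha (this ▸ mul_mem (add_mem (one_mem P) hx) (RingPreordering.inv_mem hy)))
    have hPQ : P ≤ Q := fun x hx => ⟨x, hx, 0, zero_mem P, by ring⟩
    exact hna (hP.2 trivial hPQ ⟨0, zero_mem P, 1, one_mem P, by ring⟩)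
  have : HasMemOrNegMem P := ⟨key⟩
  exact ⟨P, hTP, {}⟩

namespace OrderingSpace

variable (P : OrderingSpace F) {a b : F}

theorem mem_or_neg_mem (a : F) : a ∈ P.1 ∨ -a ∈ P.1 :=
  P.2.toHasMemOrNegMem.mem_or_neg_mem a

theorem isPos_neg_of_notMem (h : a ∉ P.1) : P.IsPos (-a) :=
  ⟨(P.mem_or_neg_mem a).resolve_left h, fun h0 => h (by simp [neg_eq_zero.1 h0])⟩

theorem isPos_or_isPos_neg (ha : a ≠ 0) : P.IsPos a ∨ P.IsPos (-a) :=
  (P.mem_or_neg_mem a).imp (⟨·, ha⟩) (⟨·, neg_ne_zero.2 ha⟩)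

theorem IsPos.not_neg_mem {P : OrderingSpace F} (h : P.IsPos a) : -a ∉ P.1 :=
  fun h' => h.2 (RingPreordering.eq_zero_of_mem_of_neg_mem h.1 h')

theorem IsPos.not_isPos_neg {P : OrderingSpace F} (h : P.IsPos a) : ¬ P.IsPos (-a) :=
  fun h' => h.not_neg_mem h'.1

theorem mem_of_isPos_of_mul_mem {P : OrderingSpace F} (ha : P.IsPos a) (h : a * b ∈ P.1) :
    b ∈ P.1 := by
  have := mul_mem (RingPreordering.inv_mem ha.1) h
  rwa [inv_mul_cancel_left₀ ha.2] at this

theorem isClosed_harrisonSet (ha : a ≠ 0) : IsClosed (harrisonSet a) := by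
  have : harrisonSet a = (harrisonSet (-a))ᶜ := by
    ext P
    exact ⟨fun h => h.not_isPos_neg, fun h => (P.isPos_or_isPos_neg ha).resolve_right h⟩
  rw [this, isClosed_compl_iff]
  exact TopologicalSpace.isOpen_generateFrom_of_mem ⟨-a, neg_ne_zero.2 ha, rfl⟩

instance [IsSemireal F] : Nonempty (OrderingSpace F) := by
  obtain ⟨P, -, hP⟩ := RingPreordering.exists_le_isOrdering
    (RingPreordering.mk' {x : F | IsSumSq x} IsSumSq.add IsSumSq.mul IsSumSq.mul_self
      (IsSemireal.not_isSumSq_neg_one F))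
  exact ⟨⟨P, hP⟩⟩

end OrderingSpace

end Orderings

/-! ### Hyperbolic and torsion forms. -/

section Hyperbolic

variable {F V W : Type*} [Field F] [AddCommGroup V] [Module F V] [AddCommGroup W] [Module F W]
  {q : QuadraticForm F V} {r : QuadraticForm F W}

theorem QuadraticMap.Equivalent.smul (a : F) (h : q.Equivalent r) : (a • q).Equivalent (a • r) := by
  obtain ⟨e⟩ := h
  exact ⟨⟨e.toLinearEquiv, fun v => by simp⟩⟩

theorem QuadraticMap.Anisotropic.of_equivalent (hq : q.Anisotropic) (h : q.Equivalent r) :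
    r.Anisotropic := by
  obtain ⟨e⟩ := h
  intro w hw
  have : e.symm w = 0 := hq _ (by simpa using hw)
  simpa using this

theorem smul_smul_self_equivalent {a : F} (ha : a ≠ 0) (b : F) (q : QuadraticForm F V) :
    ((a * a * b) • q).Equivalent (b • q) :=
  ⟨⟨LinearEquiv.smulOfNeZero F V a ha, fun v => by
    simp [QuadraticMap.map_smul]; ring⟩⟩

theorem IsHyperbolicForm.of_equivalent_dualProd [FiniteDimensional F W]
    (h : q.Equivalent (QuadraticForm.dualProd F W)) : IsHyperbolicForm q :=
  ⟨_, h.trans ⟨QuadraticForm.dualProdIsometry (Module.finBasis F W).equivFun⟩⟩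

theorem IsHyperbolicForm.congr (hq : IsHyperbolicForm q) (h : q.Equivalent r) :
    IsHyperbolicForm r :=
  hq.imp fun _ hk => h.symm.trans hk

theorem IsHyperbolicForm.prod (hq : IsHyperbolicForm q) (hr : IsHyperbolicForm r) :
    IsHyperbolicForm (q.prod r) := by
  obtain ⟨k, hk⟩ := hq
  obtain ⟨l, hl⟩ := hr
  exact .of_equivalent_dualProd
    ((QuadraticMap.Equivalent.prod hk hl).trans ⟨QuadraticForm.dualProdProdIsometry.symm⟩)

theorem IsHyperbolicForm.smul {a : F} (ha : a ≠ 0) (hq : IsHyperbolicForm q) :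
    IsHyperbolicForm (a • q) := by
  obtain ⟨k, hk⟩ := hq
  refine ⟨k, (hk.smul a).trans ⟨⟨(LinearEquiv.smulOfNeZero F _ a ha).prodCongr
    (LinearEquiv.refl F _), fun v => ?_⟩⟩⟩
  simp

/-- The isometry `(x, y) ↦ (b(x, ·) + b(y, ·), x - y)` to the hyperbolic space is injective by
anisotropy, hence bijective by dimension. -/
theorem isHyperbolicForm_prod_neg [Invertible (2 : F)] [FiniteDimensional F V]
    (hq : q.Anisotropic) : IsHyperbolicForm (q.prod (-q)) := by
  have hinj : Function.Injective (QuadraticForm.toDualProd q).toLinearMap := by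
    rw [← LinearMap.ker_eq_bot, LinearMap.ker_eq_bot']
    rintro ⟨x, y⟩ h
    have h2 : x - y = 0 := congrArg Prod.snd h
    obtain rfl : x = y := sub_eq_zero.1 h2
    have h1 : QuadraticMap.associated q x x + QuadraticMap.associated q x x = 0 :=
      LinearMap.congr_fun (congrArg Prod.fst h) x
    rw [QuadraticMap.associated_eq_self_apply, ← two_mul] at h1
    have hx : x = 0 := hq x ((mul_eq_zero.1 h1).resolve_left (Invertible.ne_zero 2))
    simp [hx]
  have hdim : Module.finrank F (V × V) = Module.finrank F (Module.Dual F V × V) := by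
    simp [Subspace.dual_finrank_eq]
  refine .of_equivalent_dualProd (W := V)
    ⟨⟨LinearEquiv.ofInjectiveOfFinrankEq _ hinj hdim, fun v => ?_⟩⟩
  exact (QuadraticForm.toDualProd q).map_app v

theorem IsTorsionForm.congr (hq : IsTorsionForm q) (h : q.Equivalent r) : IsTorsionForm r := by
  obtain ⟨m, hm, hh⟩ := hq
  exact ⟨m, hm, hh.congr (QuadraticMap.Equivalent.pi fun _ => h)⟩

theorem orthMultiple_add_equivalent (m n : ℕ) (q : QuadraticForm F V) :
    (orthMultiple (m + n) q).Equivalent ((orthMultiple m q).prod (orthMultiple n q)) := by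
  refine ⟨⟨(LinearEquiv.funCongrLeft F V finSumFinEquiv).trans
    (LinearEquiv.sumArrowLequivProdArrow _ _ F V), fun v => ?_⟩⟩
  simp [orthMultiple, Fin.sum_univ_add]

end Hyperbolic

/-! ### Round forms and their local-global principle. -/

section Round

variable {F V W : Type*} [Field F] [AddCommGroup V] [Module F V] [AddCommGroup W] [Module F W]
  {q : QuadraticForm F V} {r : QuadraticForm F W}

/-- A form is round if each of its nonzero values is a similarity factor and the form is
hyperbolic as soon as it is isotropic. -/
structure IsRoundForm (q : QuadraticForm F V) : Prop where
  similar : ∀ v, q v ≠ 0 → (q v • q).Equivalent q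
  hyperbolic : ¬ q.Anisotropic → IsHyperbolicForm q

theorem IsRoundForm.congr (hq : IsRoundForm q) (h : q.Equivalent r) : IsRoundForm r := by
  refine ⟨fun w hw => ?_, fun hr => (hq.hyperbolic fun ha => hr (ha.of_equivalent h)).congr h⟩
  obtain ⟨e⟩ := h
  have hval : q (e.symm w) = r w := e.symm.map_app w
  have := hq.similar (e.symm w) (by rwa [hval])
  rw [hval] at this
  exact ((QuadraticMap.Equivalent.smul _ ⟨e.symm⟩).trans this).trans ⟨e⟩

theorem isRoundForm_sq : IsRoundForm (QuadraticMap.sq : QuadraticForm F F) := by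
  refine ⟨fun v hv => ?_, fun h => (h fun x hx => by simpa using hx).elim⟩
  have h := smul_smul_self_equivalent (a := v) (by rintro rfl; simp at hv) 1
    (QuadraticMap.sq : QuadraticForm F F)
  simpa using h

theorem smul_prod (a : F) (q : QuadraticForm F V) (r : QuadraticForm F W) :
    a • q.prod r = (a • q).prod (a • r) := by
  ext v
  simp [mul_add]

/-- Witt's relation `⟨s, t⟩ ≅ ⟨s + t, (s + t)st⟩`, tensored with `q`. -/
theorem smul_prod_smul_equivalent {s t : F} (h : s + t ≠ 0) (q : QuadraticForm F V) :
    ((s • q).prod (t • q)).Equivalent (((s + t) • q).prod (((s + t) * s * t) • q)) := by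
  let f : V × V →ₗ[F] V × V :=
    (LinearMap.fst F V V + t • LinearMap.snd F V V).prod
      (LinearMap.fst F V V - s • LinearMap.snd F V V)
  let g : V × V →ₗ[F] V × V :=
    ((s + t)⁻¹ • (s • LinearMap.fst F V V + t • LinearMap.snd F V V)).prod
      ((s + t)⁻¹ • (LinearMap.fst F V V - LinearMap.snd F V V))
  have hfg : f ∘ₗ g = LinearMap.id := by
    refine LinearMap.ext fun ⟨x, y⟩ => Prod.ext ?_ ?_ <;>
    simp only [f, g, LinearMap.comp_apply, LinearMap.prod_apply, Function.prod_apply,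
      LinearMap.add_apply, LinearMap.sub_apply, LinearMap.smul_apply, LinearMap.fst_apply,
      LinearMap.snd_apply, LinearMap.id_apply] <;>
    match_scalars <;> field_simp <;> ring
  have hgf : g ∘ₗ f = LinearMap.id := by
    refine LinearMap.ext fun ⟨x, y⟩ => Prod.ext ?_ ?_ <;>
    simp only [f, g, LinearMap.comp_apply, LinearMap.prod_apply, Function.prod_apply,
      LinearMap.add_apply, LinearMap.sub_apply, LinearMap.smul_apply, LinearMap.fst_apply,
      LinearMap.snd_apply, LinearMap.id_apply] <;>
    match_scalars <;> field_simp <;> ring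
  refine QuadraticMap.Equivalent.symm ⟨⟨LinearEquiv.ofLinearMap f g hfg hgf, fun ⟨x, y⟩ => ?_⟩⟩
  have h1 : q (x + t • y) = q x + t * t * q y + t * QuadraticMap.polar q x y := by
    rw [QuadraticMap.map_add q, QuadraticMap.map_smul, QuadraticMap.polar_smul_right]
    simp
  have h2 : q (x - s • y) = q x + s * s * q y - s * QuadraticMap.polar q x y := by
    rw [sub_eq_add_neg, ← neg_smul, QuadraticMap.map_add q, QuadraticMap.map_smul,
      QuadraticMap.polar_smul_right]
    simp [sub_eq_add_neg]
  change s * q (x + t • y) + t * q (x - s • y) = (s + t) * q x + (s + t) * s * t * q y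
  rw [h1, h2]
  ring

/-- With `s = q u` and `t = a * q v` nonzero, roundness gives `q ⊥ aq ≅ sq ⊥ tq ≅ (s + t)(q ⊥ st
q)`, and `st q ≅ aq`. -/
theorem IsRoundForm.similar_prod (hq : IsRoundForm q) {a : F} (ha : a ≠ 0) (v : V × V)
    (hv : q.prod (a • q) v ≠ 0) : (q.prod (a • q) v • q.prod (a • q)).Equivalent (q.prod (a • q)) := by
  obtain ⟨u, v⟩ := v
  have hval : q.prod (a • q) (u, v) = q u + a * q v := by simp
  rw [hval] at hv ⊢
  rw [smul_prod]
  by_cases hu0 : q u = 0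
  · have hv0 : q v ≠ 0 := by rintro h; simp [hu0, h] at hv
    rw [hu0, zero_add]
    refine .trans (.prod (Q₁' := a • q) (Q₂' := q) ?_ ?_) ⟨QuadraticMap.IsometryEquiv.prodComm _ _⟩
    · rw [mul_smul]
      exact (hq.similar v hv0).smul a
    · rw [smul_smul, mul_right_comm]
      exact (smul_smul_self_equivalent ha _ q).trans (hq.similar v hv0)
  by_cases hv0 : q v = 0
  · rw [hv0, mul_zero, add_zero, smul_comm]
    exact .prod (hq.similar u hu0) ((hq.similar u hu0).smul a)
  have h1 : (q.prod (a • q)).Equivalent ((q u • q).prod ((a * q v) • q)) := by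
    rw [mul_smul]
    exact .prod (hq.similar u hu0).symm ((hq.similar v hv0).symm.smul a)
  refine .symm (h1.trans ((smul_prod_smul_equivalent hv q).trans (.prod (.refl _) ?_)))
  rw [show (q u + a * q v) * q u * (a * q v) = (q u + a * q v) * (a * (q u * q v)) by ring,
    mul_smul, mul_smul, mul_smul]
  exact .smul _ (.smul _ (((hq.similar v hv0).smul _).trans (hq.similar u hu0)))

theorem IsRoundForm.prod_smul [Invertible (2 : F)] [FiniteDimensional F V] (hq : IsRoundForm q)
    {a : F} (ha : a ≠ 0) : IsRoundForm (q.prod (a • q)) := by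
  refine ⟨hq.similar_prod ha, fun h => ?_⟩
  by_cases hq' : q.Anisotropic
  · simp only [QuadraticMap.Anisotropic, not_forall] at h
    obtain ⟨⟨u, v⟩, huv, h0⟩ := h
    replace huv : q u + a * q v = 0 := by simpa using huv
    have hv0 : q v ≠ 0 := by
      intro h
      have hu : q u = 0 := by simpa [h] using huv
      exact h0 (by rw [hq' u hu, hq' v h]; rfl)
    have hu0 : q u ≠ 0 := by
      intro h
      simp [h, ha, hv0] at huv
    -- Since `a * q v = -q u`, absorbing similarity factors gives `aq ≅ -q`.
    refine (isHyperbolicForm_prod_neg hq').congr (.prod (.refl _) (.symm ?_))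
    have h1 := (hq.similar v hv0).symm.smul a
    rw [smul_smul, show a * q v = -1 * q u by linear_combination huv, mul_smul] at h1
    have hneg : (-1 : F) • q = -q := by ext; simp
    exact hneg ▸ h1.trans ((hq.similar u hu0).smul (-1))
  · exact (hq.hyperbolic hq').prod ((hq.hyperbolic hq').smul ha)

theorem IsRoundForm.orthMultiple_two_pow [Invertible (2 : F)] [FiniteDimensional F V]
    (hq : IsRoundForm q) (k : ℕ) : IsRoundForm (orthMultiple (2 ^ k) q) := by
  induction k with
  | zero =>
    rw [pow_zero]
    refine hq.congr (.symm ⟨⟨LinearEquiv.funUnique (Fin 1) F V, fun v => ?_⟩⟩)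
    simp [orthMultiple]
  | succ k ih =>
    rw [pow_succ, mul_two]
    have := ih.prod_smul (one_ne_zero (α := F))
    rw [one_smul] at this
    exact this.congr (orthMultiple_add_equivalent _ _ q).symm

theorem IsRoundForm.exists_mul (hq : IsRoundForm q) (u v : V) : ∃ w, q w = q u * q v := by
  by_cases hu : q u = 0
  · exact ⟨0, by simp [hu]⟩
  · obtain ⟨e⟩ := hq.similar u hu
    exact ⟨e v, by simp⟩

theorem exists_orthMultiple_eq_of_mem_closure {z : F}
    (hz : z ∈ AddSubmonoid.closure (Set.range q)) : ∃ m w, orthMultiple m q w = z := by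
  induction hz using AddSubmonoid.closure_induction with
  | mem x hx =>
    obtain ⟨v, rfl⟩ := hx
    exact ⟨1, fun _ => v, by simp [orthMultiple]⟩
  | zero => exact ⟨0, 0, by simp [orthMultiple]⟩
  | add x y _ _ hx hy =>
    obtain ⟨m, v, rfl⟩ := hx
    obtain ⟨n, w, rfl⟩ := hy
    obtain ⟨e⟩ := orthMultiple_add_equivalent m n q
    exact ⟨m + n, e.symm (v, w), by rw [e.symm.map_app]; rfl⟩

/-- The local-global principle for round forms: a round form that represents `1` and is
positive semidefinite at no ordering is torsion. -/
theorem IsRoundForm.isTorsionForm [Invertible (2 : F)] [FiniteDimensional F V]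
    (hq : IsRoundForm q) {e : V} (he : q e = 1) (h : ∀ P : OrderingSpace F, ∃ v, q v ∉ P.1) :
    IsTorsionForm q := by
  -- Roundness makes the values multiplicative, so sums of values form a preordering unless they
  -- include `-1`.
  let M : Submonoid F :=
    { carrier := Set.range q
      one_mem' := ⟨e, he⟩
      mul_mem' := by
        rintro _ _ ⟨u, rfl⟩ ⟨v, rfl⟩
        exact hq.exists_mul u v }
  have hmem : ∀ z, z ∈ M.subsemiringClosure ↔ z ∈ AddSubmonoid.closure (Set.range q) :=
    fun _ => Iff.rfl
  have h1 : (-1 : F) ∈ AddSubmonoid.closure (Set.range q) := by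
    by_contra hneg
    obtain ⟨P, hTP, hP⟩ := RingPreordering.exists_le_isOrdering
      { M.subsemiringClosure with
        mem_of_isSquare' := by
          rintro _ ⟨x, rfl⟩
          exact (hmem _).2 (AddSubmonoid.subset_closure ⟨x • e, by simp [QuadraticMap.map_smul, he]⟩)
        neg_one_notMem' := hneg }
    obtain ⟨v, hv⟩ := h ⟨P, hP⟩
    exact hv (hTP ((hmem _).2 (AddSubmonoid.subset_closure ⟨v, rfl⟩)))
  obtain ⟨m, w, hw⟩ := exists_orthMultiple_eq_of_mem_closure h1
  have hiso : ¬ (orthMultiple (1 + m) q).Anisotropic := by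
    intro ha
    have h0 := ha.of_equivalent (orthMultiple_add_equivalent 1 m q) (fun _ => e, w)
      (by rw [QuadraticMap.prod_apply, hw]; simp [orthMultiple, he])
    have : e = 0 := congrFun (congrArg Prod.fst h0) 0
    simp [this] at he
  -- Roundness survives only doubling, so the isotropic `1 + m` copies are embedded in `2 ^ (1 + m)`
  -- copies.
  refine ⟨2 ^ (1 + m), Nat.one_le_two_pow, (hq.orthMultiple_two_pow _).hyperbolic fun ha => hiso ?_⟩
  obtain ⟨k, hk⟩ := Nat.exists_eq_add_of_le (Nat.lt_two_pow_self (n := 1 + m)).le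
  rw [hk] at ha
  exact (QuadraticMap.anisotropic_of_prod
    (ha.of_equivalent (orthMultiple_add_equivalent _ _ q))).1

end Round

/-! ### Comparison of the two invariants. -/

section Invariants

variable {F : Type*} [Field F]

theorem le_uInvariant {V : Type*} [AddCommGroup V] [Module F V] [FiniteDimensional F V]
    {q : QuadraticForm F V} (ha : q.Anisotropic) (ht : IsTorsionForm q) :
    (Module.finrank F V : ℕ∞) ≤ uInvariant F := by
  have e : q.Equivalent (q.basisRepr (Module.finBasis F V)) := ⟨q.isometryEquivBasisRepr _⟩
  exact le_sSup ⟨_, _, ha.of_equivalent e, ht.congr e, rfl⟩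

theorem IsTorsionForm.exists_notMem {V : Type*} [AddCommGroup V] [Module F V] [Nontrivial V]
    {q : QuadraticForm F V} (ha : q.Anisotropic) (ht : IsTorsionForm q) (P : OrderingSpace F) :
    (∃ x, q x ∉ P.1) ∧ ∃ x, -q x ∉ P.1 := by
  obtain ⟨m, hm, k, ⟨e⟩⟩ := ht
  have : NeZero m := ⟨by omega⟩
  have hk : k ≠ 0 := by
    rintro rfl
    exact not_subsingleton _ e.toLinearEquiv.toEquiv.subsingleton
  have : NeZero k := ⟨hk⟩
  obtain ⟨y, hy⟩ := exists_ne (0 : Fin k → F)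
  have hv : orthMultiple m q (e.symm (0, y)) = 0 := by
    rw [e.symm.map_app]
    simp
  have hv0 : e.symm (0, y) ≠ 0 := by
    intro h
    have := congrArg e h
    rw [e.apply_symm_apply] at this
    exact hy (by simpa using this)
  set v := e.symm (0, y)
  obtain ⟨i, hi⟩ := Function.ne_iff.1 hv0
  have hsum : q (v i) + ∑ j ∈ Finset.univ.erase i, q (v j) = 0 := by
    rw [Finset.add_sum_erase _ (fun j => q (v j)) (Finset.mem_univ i)]
    simpa [orthMultiple] using hv
  constructor <;> by_contra! h
  · refine hi (ha _ (RingPreordering.eq_zero_of_mem_of_neg_mem (h _) ?_))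
    rw [neg_eq_of_add_eq_zero_right hsum]
    exact sum_mem fun j _ => h _
  · refine hi (ha _ (RingPreordering.eq_zero_of_mem_of_neg_mem ?_ (h _)))
    rw [eq_neg_of_add_eq_zero_left hsum, ← Finset.sum_neg_distrib]
    exact sum_mem fun j _ => h _

theorem uInvariant_le_hasseNumber : uInvariant F ≤ hasseNumber F := by
  refine sSup_le ?_
  rintro _ ⟨n, q, ha, ht, rfl⟩
  -- The zero form is torsion but not indefinite; its dimension is harmless.
  rcases n with _ | n
  · simp
  · refine le_sSup ⟨n + 1, q, ha, fun P => ?_, rfl⟩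
    obtain ⟨⟨x, hx⟩, ⟨y, hy⟩⟩ := ht.exists_notMem ha P
    exact ⟨⟨y, by simpa using P.isPos_neg_of_notMem hy⟩, ⟨x, P.isPos_neg_of_notMem hx⟩⟩

/-- An anisotropic totally indefinite binary form `⟨a, b⟩` yields the anisotropic torsion form
`⟨1, ab⟩`. -/
theorem two_le_uInvariant [Invertible (2 : F)] {a b : F} (ha : a ≠ 0) (hb : b ≠ 0)
    (h : ∀ P : OrderingSpace F, a * b ∉ P.1)
    (haniso : ∀ x y : F, a * (x * x) + b * (y * y) = 0 → x = 0 ∧ y = 0) :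
    2 ≤ uInvariant F := by
  have hr : IsRoundForm ((QuadraticMap.sq : QuadraticForm F F).prod
    ((a * b) • (QuadraticMap.sq : QuadraticForm F F))) :=
    isRoundForm_sq.prod_smul (mul_ne_zero ha hb)
  have ht := hr.isTorsionForm (e := (1, 0)) (by simp) fun P => ⟨(0, 1), by simpa using h P⟩
  refine le_of_eq_of_le (by norm_num) (le_uInvariant ?_ ht)
  rintro ⟨x, y⟩ hxy
  obtain ⟨h1, h2⟩ := haniso x (a * y) (by
    have hxy' : x * x + a * b * (y * y) = 0 := by simpa using hxy
    linear_combination a * hxy')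
  simpa [ha] using And.intro h1 h2

/-- If `u(F) ≤ 2`, totally indefinite ternary forms are isotropic. -/
theorem exists_ternary_eq_zero [Invertible (2 : F)] (hu : uInvariant F ≤ 2) {a b c : F}
    (ha : a ≠ 0) (hb : b ≠ 0) (hc : c ≠ 0)
    (hpos : ∀ P : OrderingSpace F, ¬ (P.IsPos a ∧ P.IsPos b ∧ P.IsPos c))
    (hneg : ∀ P : OrderingSpace F, ¬ (P.IsPos (-a) ∧ P.IsPos (-b) ∧ P.IsPos (-c))) :
    ∃ x y z : F, (x ≠ 0 ∨ y ≠ 0 ∨ z ≠ 0) ∧ a * (x * x) + b * (y * y) + c * (z * z) = 0 := by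
  have hψ : IsRoundForm ((QuadraticMap.sq : QuadraticForm F F).prod
    ((a * b) • (QuadraticMap.sq : QuadraticForm F F))) :=
    isRoundForm_sq.prod_smul (mul_ne_zero ha hb)
  set ψ := (QuadraticMap.sq : QuadraticForm F F).prod
    ((a * b) • (QuadraticMap.sq : QuadraticForm F F)) with hψ_def
  have hψv : ∀ x y, ψ (x, y) = x * x + a * b * (y * y) := fun x y => by simp [hψ_def]
  have ht := (hψ.prod_smul (mul_ne_zero ha hc)).isTorsionForm (e := ((1, 0), (0, 0)))
    (by simp [hψv]) fun P => by
      by_contra! h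
      have hab : a * b ∈ P.1 := by simpa [hψv] using h ((0, 1), (0, 0))
      have hac : a * c ∈ P.1 := by simpa [hψv] using h ((0, 0), (1, 0))
      rcases P.isPos_or_isPos_neg ha with hP | hP
      · exact hpos P ⟨hP, ⟨OrderingSpace.mem_of_isPos_of_mul_mem hP hab, hb⟩,
          ⟨OrderingSpace.mem_of_isPos_of_mul_mem hP hac, hc⟩⟩
      · exact hneg P ⟨hP,
          ⟨OrderingSpace.mem_of_isPos_of_mul_mem hP (by simpa using hab), neg_ne_zero.2 hb⟩,
          ⟨OrderingSpace.mem_of_isPos_of_mul_mem hP (by simpa using hac), neg_ne_zero.2 hc⟩⟩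
  have hiso : ¬ (ψ.prod ((a * c) • ψ)).Anisotropic := fun h => by
    have := (le_uInvariant h ht).trans hu
    simp at this
    norm_num at this
  simp only [QuadraticMap.Anisotropic, not_forall] at hiso
  obtain ⟨⟨u, v⟩, huv, h0⟩ := hiso
  replace huv : ψ u + a * c * ψ v = 0 := by simpa using huv
  by_cases hψa : ψ.Anisotropic
  · have hv0 : ψ v ≠ 0 := by
      intro h
      have hu0 : ψ u = 0 := by simpa [h] using huv
      exact h0 (by rw [hψa u hu0, hψa v h]; rfl)
    -- Here `ψ (x, y) = ψ u * ψ v = -ac (ψ v)²`, while `⟨a, b⟩` takes the value `a * ψ (x, y)` at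
    -- `(x, ay)`.
    obtain ⟨⟨x, y⟩, hw⟩ := hψ.exists_mul u v
    rw [hψv] at hw
    refine ⟨x, a * y, a * ψ v, .inr (.inr (mul_ne_zero ha hv0)), ?_⟩
    linear_combination a * hw + a * ψ v * huv
  · simp only [QuadraticMap.Anisotropic, not_forall] at hψa
    obtain ⟨⟨x, y⟩, hxy, h0⟩ := hψa
    rw [hψv] at hxy
    refine ⟨x, a * y, 0, ?_, by linear_combination a * hxy⟩
    by_contra! h
    exact h0 (by rw [h.1, (mul_eq_zero.1 h.2.1).resolve_left ha]; rfl)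

/-- If `F` is a SAP field with `u(F) ≤ 2`, totally indefinite diagonal forms of dimension at least
`3` are isotropic. -/
theorem exists_weightedSum_eq_zero [Invertible (2 : F)] (hSAP : IsSAP F) (hu : uInvariant F ≤ 2)
    (n : ℕ) (w : Fin (n + 3) → F) (hw : ∀ i, w i ≠ 0)
    (hpos : ∀ P : OrderingSpace F, ¬ ∀ i, P.IsPos (w i))
    (hneg : ∀ P : OrderingSpace F, ¬ ∀ i, P.IsPos (-w i)) :
    ∃ x : Fin (n + 3) → F, x ≠ 0 ∧ ∑ i, w i * (x i * x i) = 0 := by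
  induction n with
  | zero =>
    obtain ⟨x, y, z, h0, h⟩ := exists_ternary_eq_zero hu (hw 0) (hw 1) (hw 2)
      (fun P h => hpos P fun i => by fin_cases i <;> [exact h.1; exact h.2.1; exact h.2.2])
      (fun P h => hneg P fun i => by fin_cases i <;> [exact h.1; exact h.2.1; exact h.2.2])
    refine ⟨![x, y, z], ?_, by simpa [Fin.sum_univ_three] using h⟩
    rintro h'
    have h1 := congrFun h' 0
    have h2 := congrFun h' 1
    have h3 := congrFun h' 2
    simp at h1 h2 h3
    simp [h1, h2, h3] at h0
  | succ n ih =>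
    obtain ⟨a, w, rfl⟩ : ∃ a v, w = Fin.cons a v := ⟨_, _, (Fin.cons_self_tail w).symm⟩
    obtain ⟨b, r, rfl⟩ : ∃ b v, w = Fin.cons b v := ⟨_, _, (Fin.cons_self_tail w).symm⟩
    simp only [Fin.forall_fin_succ (n := n + 3), Fin.forall_fin_succ (n := n + 2), Fin.cons_zero,
      Fin.cons_succ] at hw hpos hneg
    obtain ⟨ha, hb, hr⟩ := hw
    -- `d` must oppose the sign of `r` where `r` is definite, and share that of `⟨a, b⟩` where `⟨a,
    -- b⟩` is definite. Total indefiniteness makes these demands compatible.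
    obtain ⟨d, hd, hdA, hdB⟩ := hSAP
      ((⋂ i, harrisonSet (-r i)) ∪ (harrisonSet a ∩ harrisonSet b))
      ((⋂ i, harrisonSet (r i)) ∪ (harrisonSet (-a) ∩ harrisonSet (-b)))
      ((isClosed_iInter fun i => OrderingSpace.isClosed_harrisonSet (neg_ne_zero.2 (hr i))).union
        ((OrderingSpace.isClosed_harrisonSet ha).inter (OrderingSpace.isClosed_harrisonSet hb)))
      ((isClosed_iInter fun i => OrderingSpace.isClosed_harrisonSet (hr i)).union
        ((OrderingSpace.isClosed_harrisonSet (neg_ne_zero.2 ha)).inter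
          (OrderingSpace.isClosed_harrisonSet (neg_ne_zero.2 hb))))
      (by
        rw [Set.disjoint_left]
        rintro P (h | ⟨h1, h2⟩) (h' | ⟨h1', h2'⟩)
        · exact OrderingSpace.IsPos.not_isPos_neg (Set.mem_iInter.1 h' 0) (Set.mem_iInter.1 h 0)
        · exact hneg P ⟨h1', h2', Set.mem_iInter.1 h⟩
        · exact hpos P ⟨h1, h2, Set.mem_iInter.1 h'⟩
        · exact OrderingSpace.IsPos.not_isPos_neg h1 h1')
    obtain ⟨x, y, z, h0, hxyz⟩ := exists_ternary_eq_zero hu ha hb (neg_ne_zero.2 hd)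
      (fun P h => (hdA P (.inr ⟨h.1, h.2.1⟩)).not_isPos_neg h.2.2)
      (fun P h => (hdB P (.inr ⟨h.1, h.2.1⟩)).not_isPos_neg h.2.2)
    by_cases hz : z = 0
    · refine ⟨Fin.cons x (Fin.cons y 0), fun h => ?_, ?_⟩
      · have h1 := congrFun h 0
        have h2 := congrFun h 1
        rw [← Fin.succ_zero_eq_one, Fin.cons_succ] at h2
        simp at h1 h2
        simp [h1, h2, hz] at h0
      · rw [Fin.sum_univ_succ, Fin.sum_univ_succ]
        simpa [hz] using hxyz
    · obtain ⟨t, ht, hsum⟩ := ih (Fin.cons d r) (Fin.cases hd hr)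
        (fun P h => (hdB P (.inl (Set.mem_iInter.2 fun i => h i.succ))).not_isPos_neg
          (by simpa using h 0))
        (fun P h => (hdA P (.inl (Set.mem_iInter.2 fun i => h i.succ))).not_isPos_neg
          (h 0))
      obtain ⟨t₀, t, rfl⟩ : ∃ a v, t = Fin.cons a v := ⟨_, _, (Fin.cons_self_tail t).symm⟩
      rw [Fin.sum_univ_succ] at hsum
      simp only [Fin.cons_zero, Fin.cons_succ] at hsum
      have hd' : a * (x / z * (x / z)) + b * (y / z * (y / z)) = d := by
        field_simp
        linear_combination hxyz
      -- Replace `d * t₀²` by its expression through `⟨a, b⟩`.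
      refine ⟨Fin.cons (x / z * t₀) (Fin.cons (y / z * t₀) t), fun h => ht ?_, ?_⟩
      · have h1 := congrFun h 0
        have h2 := congrFun h 1
        have h3 : t = 0 := funext fun i => congrFun h i.succ.succ
        rw [← Fin.succ_zero_eq_one, Fin.cons_succ] at h2
        simp only [Fin.cons_zero, Pi.zero_apply] at h1 h2
        have h4 : t₀ = 0 := by
          by_contra ht₀
          apply hd
          rw [← hd', (mul_eq_zero.1 h1).resolve_right ht₀, (mul_eq_zero.1 h2).resolve_right ht₀]
          ring
        rw [h3, h4]
        exact Fin.cons_self_tail 0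
      · rw [Fin.sum_univ_succ, Fin.sum_univ_succ]
        simp only [Fin.cons_zero, Fin.cons_succ]
        linear_combination hsum + t₀ * t₀ * hd'

theorem hasseNumber_le_uInvariant [IsSemireal F] (hSAP : IsSAP F) (hu : uInvariant F ≤ 2) :
    hasseNumber F ≤ uInvariant F := by
  have : Invertible (2 : F) := invertibleOfNonzero two_ne_zero
  refine sSup_le ?_
  rintro _ ⟨n, q, ha, hq, rfl⟩
  obtain ⟨w, ⟨e⟩⟩ : ∃ w : Fin n → F, q.Equivalent (QuadraticMap.weightedSumSquares F w) := by
    have h := q.equivalent_weightedSumSquares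
    rwa [Module.finrank_fin_fun] at h
  have hsum : ∀ x, QuadraticMap.weightedSumSquares F w x = ∑ i, w i * (x i * x i) := fun x => by
    simp [QuadraticMap.weightedSumSquares_apply]
  have hw' : ∀ x : Fin n → F, ∑ i, w i * (x i * x i) = 0 → x = 0 := fun x hx =>
    ha.of_equivalent ⟨e⟩ x (by rw [hsum, hx])
  have hw : ∀ i, w i ≠ 0 := fun i hi => by
    have := congrFun (hw' (Pi.single i 1) (by
      refine Finset.sum_eq_zero fun j _ => ?_
      by_cases hj : j = i
      · simp [hj, hi]
      · simp [hj])) i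
    simp at this
  have hval : ∀ v, q v = ∑ i, w i * (e v i * e v i) := fun v => by
    rw [← hsum, e.map_app]
  have hpos : ∀ P : OrderingSpace F, ¬ ∀ i, P.IsPos (w i) := fun P h => by
    obtain ⟨v, hv⟩ := (hq P).2
    refine OrderingSpace.IsPos.not_neg_mem hv ?_
    rw [neg_neg, hval]
    exact sum_mem fun i _ => mul_mem (h i).1 (P.1.mul_self_mem _)
  have hneg : ∀ P : OrderingSpace F, ¬ ∀ i, P.IsPos (-w i) := fun P h => by
    obtain ⟨v, hv⟩ := (hq P).1
    refine OrderingSpace.IsPos.not_neg_mem hv ?_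
    rw [hval, ← Finset.sum_neg_distrib]
    refine sum_mem fun i _ => ?_
    rw [← neg_mul]
    exact mul_mem (h i).1 (P.1.mul_self_mem _)
  obtain ⟨P₀⟩ : Nonempty (OrderingSpace F) := inferInstance
  match n, w, hw, hw', hpos, hneg with
  | 0, _, _, _, _, _ => simp
  | 1, w, hw, _, hpos, hneg =>
    refine ((P₀.isPos_or_isPos_neg (hw 0)).elim (fun h => hpos P₀ fun i => ?_)
      (fun h => hneg P₀ fun i => ?_)).elim <;> rwa [Subsingleton.elim i 0]
  | 2, w, hw, hw', hpos, hneg =>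
    refine two_le_uInvariant (hw 0) (hw 1) (fun P h => ?_) fun x y hxy => ?_
    · rcases P.isPos_or_isPos_neg (hw 0) with hP | hP
      · exact hpos P (Fin.forall_fin_two.2
          ⟨hP, OrderingSpace.mem_of_isPos_of_mul_mem hP h, hw 1⟩)
      · exact hneg P (Fin.forall_fin_two.2
          ⟨hP, OrderingSpace.mem_of_isPos_of_mul_mem hP (by simpa using h), neg_ne_zero.2 (hw 1)⟩)
    · have := hw' ![x, y] (by simpa using hxy)
      exact ⟨congrFun this 0, congrFun this 1⟩
  | n + 3, w, hw, hw', hpos, hneg =>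
    obtain ⟨x, hx, h⟩ := exists_weightedSum_eq_zero hSAP hu n w hw hpos hneg
    exact (hx (hw' x h)).elim

end Invariants

theorem mainTheorem3 {F : Type*} [Field F] [IsSemireal F]
    (hSAP : IsSAP F) (hu : uInvariant F ≤ 2) :
    uInvariant F = hasseNumber F :=
  uInvariant_le_hasseNumber.antisymm (hasseNumber_le_uInvariant hSAP hu)
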